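/- Let $T_n = C_n \square C_n$ be the toroidal grid with vertex set $\mathbb{Z}_n \times \mathbb{Z}_n$ and let $M = \lfloor n/4 \rfloor$. A strategy $\mathcal{S}$ of the survivor consists of a starting vertex and of a sequence of $M$ moves (West, East, North, South or stay put), both fixed in advance; let $(a,b)$ be the vertex at which he finishes. The game lasts $M$ rounds. In each round the survivor makes his next move, and the zombie moves to a neighbour of her current vertex that is strictly closer in $T_n$ to the current vertex of the survivor, chosen uniformly at random among all such neighbours. The zombie eats the survivor if at some time they are at the same vertex. For $x,y \in \mathbb{Z}$ let $p_{\mathcal{S}}(x,y)$ be the probability that a zombie starting at $(a+x,b+y)$ eats the survivor who uses $\mathcal{S}$, and put $$t(\mathcal{S}) = \sum_{x=-M}^{M}\sum_{y=-M}^{M} p_{\mathcal{S}}(x,y), \qquad t_n = \min_{\mathcal{S}} t(\mathcal{S}),$$ where the minimum is over all $n^2 5^M$ strategies. Let $\mathcal{S}_d$ be the strategy that starts at $(\lfloor M/2\rfloor, \lceil M/2\rceil)$ and goes along the diagonal to $(0,0)$ by the moves South, West, South, West, and so on ($M$ moves in all). Theorem. As $n \to \infty$, $t(\mathcal{S}_d)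 = O(n^{3/2})$. Consequently $t_n = O(n^{3/2})$, and $t_n > 0$ for all large $n$ and $n^{3/2} = O(n^3/t_n)$; that is, the upper bound $z(T_n) = O(n^3/t_n)$ on the zombie number of $T_n$ cannot give anything better than $O(n^{3/2})$. All of this holds for each of the two orders of play: the zombie moves first in every round, or the survivor moves first in every round. -/

import Mathlib

open Filter Asymptotics

namespace ZombieTorus

/-- The vertex set `ℤ_n × ℤ_n` of the toroidal grid `T_n`. -/
abbrev Vertex (n : ℕ) : Type := ZMod n × ZMod n

/-- The cycle `C_n` on the vertex set `ℤ_n` (`a` and `a + 1` are joined). -/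
def cycle (n : ℕ) : SimpleGraph (ZMod n) := SimpleGraph.circulantGraph {1}

/-- The toroidal grid `T_n`, the Cartesian product of two copies of `C_n`. -/
def torus (n : ℕ) : SimpleGraph (Vertex n) := (cycle n).boxProd (cycle n)

/-- The neighbours of `z` in `T_n` that are strictly closer to `s` than `z` is, that is, the
second vertices of the shortest paths from `z` to `s`. -/
def closer (n : ℕ) (s z : Vertex n) : Set (Vertex n) :=
  {w | (torus n).Adj z w ∧ (torus n).dist w s < (torus n).dist z s}

open Classical in
/-- The random move of a zombie at `z` when the survivor is at `s`: a uniformly random neighbour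
of `z` that is closer to `s`. If there is none (that is, if `z = s`), she stays. -/
noncomputable def zombieStep (n : ℕ) (s z : Vertex n) : PMF (Vertex n) :=
  if h : (closer n s z).Finite ∧ (closer n s z).Nonempty then
    PMF.uniformOfFinset h.1.toFinset (h.1.toFinset_nonempty.mpr h.2)
  else PMF.pure z

/-- The options of the survivor in each round. -/
inductive Move
  | west | east | north | south | stay

/-- The displacement of the survivor caused by a move. -/
def Move.vec (n : ℕ) : Move → Vertex n
  | .west => (-1, 0)
  | .east => (1, 0)
  | .north => (0, 1)
  | .south => (0, -1)
  | .stay => (0, 0)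

/-- The number `M = ⌊n/4⌋` of rounds. -/
def rounds (n : ℕ) : ℕ := n / 4

/-- The family `𝓕`: a starting vertex and a sequence of `M` moves, both fixed in advance. -/
structure Strategy (n : ℕ) where
  start : Vertex n
  move : Fin (rounds n) → Move

/-- The vertex at which the survivor finishes his walk. -/
def Strategy.final {n : ℕ} (S : Strategy n) : Vertex n := S.start + ∑ i, (S.move i).vec n

/-- Who moves first in a round. With `zombies`, the zombie's `i`-th move is directed at the
position of the survivor after `i - 1` of his moves; with `survivor`, at the one after `i` of
his moves (so that her last move is directed at his final position). -/
inductive MovesFirst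
  | zombies | survivor

open Classical in
/-- The outcome (`true` if the survivor is eaten) of the game of one zombie at `z` against the
survivor at `s` who is going to make the given moves, one in each round. The survivor is eaten
as soon as he and the zombie are at the same vertex. -/
noncomputable def play (τ : MovesFirst) (n : ℕ) : List Move → Vertex n → Vertex n → PMF Bool
  | [], s, z => PMF.pure (decide (z = s))
  | m :: l, s, z =>
    if z = s then PMF.pure true
    else match τ with
      | .zombies => (zombieStep n s z).bind fun w =>
          if w = s then PMF.pure true else play τ n l (s + m.vec n) w
      | .survivor => (zombieStep n (s + m.vec n) z).bind fun w => play τ n l (s + m.vec n) w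

/-- `p_S(x, y)`: the probability that a zombie starting at `(a + x, b + y)` eats the survivor who
uses the strategy `S`, where `(a, b)` is the vertex at which `S` finishes. -/
noncomputable def eatProb (τ : MovesFirst) {n : ℕ} (S : Strategy n) (x y : ℤ) : ℝ :=
  (play τ n (List.ofFn S.move) S.start (S.final + ((x : ZMod n), (y : ZMod n))) true).toReal

/-- The total weight `t(S)`, the sum of `p_S(x, y)` over `-M ≤ x, y ≤ M`. -/
noncomputable def weight (τ : MovesFirst) {n : ℕ} (S : Strategy n) : ℝ :=
  ∑ x ∈ Finset.Icc (-(rounds n : ℤ)) (rounds n),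
    ∑ y ∈ Finset.Icc (-(rounds n : ℤ)) (rounds n), eatProb τ S x y

/-- `t_n`, the minimum of `t(S)` over the strategies `S` (a finite family if `n ≥ 1`). -/
noncomputable def minWeight (τ : MovesFirst) (n : ℕ) : ℝ := ⨅ S : Strategy n, weight τ S

/-- Strategy (d): start at `(⌊M/2⌋, ⌈M/2⌉)` and go along the diagonal, South, West, South, … -/
def diagonal (n : ℕ) : Strategy n where
  start := (((rounds n / 2 : ℕ) : ZMod n), (((rounds n + 1) / 2 : ℕ) : ZMod n))
  move i := if (i : ℕ) % 2 = 0 then .south else .west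

end ZombieTorus

/-!
The zombies are followed in coordinates relative to the survivor, and these two coordinates are
exchanged after each of his moves, so that every move of the diagonal strategy has the same effect.
A zombie to the north-east of the survivor and not next to him never catches up with him, so only
the density of those that are to his south or west has to be controlled. Starting from density at
most `1` everywhere, the density of the zombies stays below an explicit solution of a discrete heat
equation, which after `O(n)` half-rounds is still of order `√n` near the survivor. Hence each
half-round costs `O(√n)` expected zombies, and the whole walk `O(n * √n)`. The lower bound
`1 ≤ t(S)` comes from the zombie that starts at the starting vertex of the survivor.
-/

namespace ZombieTorus

section Distance

variable {n : ℕ}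

lemma cycle_adj_iff (hn : 2 ≤ n) (a b : ZMod n) : (cycle n).Adj a b ↔ b = a + 1 ∨ b = a - 1 := by
  have : Fact (1 < n) := ⟨hn⟩
  simp only [cycle, SimpleGraph.circulantGraph_adj, Set.mem_singleton_iff]
  constructor
  · rintro ⟨-, h | h⟩
    · exact .inr (by rw [← h]; ring)
    · exact .inl (by rw [← h]; ring)
  · rintro (rfl | rfl) <;> simp [eq_sub_iff_add_eq]

lemma cycle_edist_add_one_le (a : ZMod n) : (cycle n).edist a (a + 1) ≤ 1 := by
  rw [SimpleGraph.edist_le_one_iff_adj_or_eq]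
  by_cases h : a = a + 1
  · exact .inr h
  · exact .inl (by simpa [cycle] using h)

lemma cycle_edist_add_natCast_le (a : ZMod n) (k : ℕ) : (cycle n).edist a (a + k) ≤ k := by
  induction k with
  | zero => simp
  | succ k ih =>
    rw [Nat.cast_succ, Nat.cast_succ, ← add_assoc]
    exact SimpleGraph.edist_triangle.trans (add_le_add ih (cycle_edist_add_one_le _))

lemma cycle_edist_add_intCast_le (a : ZMod n) (x : ℤ) :
    (cycle n).edist a (a + (x : ZMod n)) ≤ x.natAbs := by
  rcases Int.natAbs_eq x with hx | hx
  · have h := cycle_edist_add_natCast_le a x.natAbs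
    rwa [← Int.cast_natCast (R := ZMod n), ← hx] at h
  · have h := cycle_edist_add_natCast_le (a + (x : ZMod n)) x.natAbs
    rwa [← Int.cast_natCast (R := ZMod n), add_assoc, ← Int.cast_add,
      show x + (x.natAbs : ℤ) = 0 by omega, Int.cast_zero, add_zero, SimpleGraph.edist_comm] at h

lemma valMinAbs_intCast {x : ℤ} (hx : 2 * |x| < n) : (x : ZMod n).valMinAbs = x := by
  have : NeZero n := ⟨by rintro rfl; have := abs_nonneg x; omega⟩
  rw [ZMod.valMinAbs_spec]
  exact ⟨rfl, by grind, by grind⟩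

lemma natAbs_valMinAbs_one_le (n : ℕ) : (1 : ZMod n).valMinAbs.natAbs ≤ 1 := by
  rcases lt_trichotomy n 1 with hn | rfl | hn
  · obtain rfl : n = 0 := by omega
    simp
  · rw [Subsingleton.elim (1 : ZMod 1) 0]; simp
  · rw [← Nat.cast_one, ZMod.valMinAbs_natCast_of_le_half (by omega)]; simp

lemma natAbs_valMinAbs_sub_le_one {a b : ZMod n} (h : (cycle n).Adj a b) :
    (b - a).valMinAbs.natAbs ≤ 1 := by
  rw [cycle, SimpleGraph.circulantGraph_adj] at h
  rcases h.2 with h | h <;> rw [Set.mem_singleton_iff] at h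
  · rw [← ZMod.natAbs_valMinAbs_neg, neg_sub, h]
    exact natAbs_valMinAbs_one_le n
  · rw [h]
    exact natAbs_valMinAbs_one_le n

lemma natAbs_valMinAbs_sub_le_length {a b : ZMod n} (w : (cycle n).Walk a b) :
    (b - a).valMinAbs.natAbs ≤ w.length := by
  induction w with
  | nil => simp
  | @cons a c b h w ih =>
    have hadd := ZMod.natAbs_valMinAbs_add_le (c - a) (b - c)
    rw [sub_add_sub_cancel'] at hadd
    have htri := Int.natAbs_add_le (c - a).valMinAbs (b - c).valMinAbs
    have hone := natAbs_valMinAbs_sub_le_one h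
    rw [SimpleGraph.Walk.length_cons]
    omega

lemma cycle_edist (a b : ZMod n) : (cycle n).edist a b = (b - a).valMinAbs.natAbs := by
  apply le_antisymm
  · simpa using cycle_edist_add_intCast_le a (b - a).valMinAbs
  · exact le_iInf fun w => Nat.cast_le.2 (natAbs_valMinAbs_sub_le_length w)

lemma torus_dist (z w : Vertex n) : (torus n).dist z w =
    (w.1 - z.1).valMinAbs.natAbs + (w.2 - z.2).valMinAbs.natAbs := by
  rw [SimpleGraph.dist, torus, SimpleGraph.edist_boxProd, cycle_edist, cycle_edist]
  rfl

end Distance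

/-- The reduction `ℤ × ℤ → ℤ_n × ℤ_n` modulo `n`. -/
def red (n : ℕ) : ℤ × ℤ →+ Vertex n := (Int.castAddHom _).prodMap (Int.castAddHom _)

lemma red_apply (n : ℕ) (D : ℤ × ℤ) : red n D = ((D.1 : ZMod n), (D.2 : ZMod n)) := rfl

lemma red_eq_zero_iff {n : ℕ} {D : ℤ × ℤ} (h₁ : |D.1| < n) (h₂ : |D.2| < n) :
    red n D = 0 ↔ D = 0 := by
  simp only [red_apply, Prod.ext_iff, Prod.fst_zero, Prod.snd_zero,
    ZMod.intCast_zmod_eq_zero_iff_dvd]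
  exact ⟨fun h => ⟨Int.eq_zero_of_abs_lt_dvd h.1 h₁, Int.eq_zero_of_abs_lt_dvd h.2 h₂⟩,
    fun h => by simp [h]⟩

lemma torus_dist_add_red {n : ℕ} (s : Vertex n) {D : ℤ × ℤ} (h₁ : 2 * |D.1| < n)
    (h₂ : 2 * |D.2| < n) : (torus n).dist (s + red n D) s = D.1.natAbs + D.2.natAbs := by
  rw [SimpleGraph.dist_comm, torus_dist, Prod.fst_add, Prod.snd_add, add_sub_cancel_left,
    add_sub_cancel_left, red_apply, valMinAbs_intCast h₁, valMinAbs_intCast h₂]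

/-- The four unit vectors of the grid. -/
def unitVectors : Finset (ℤ × ℤ) := {(1, 0), (-1, 0), (0, 1), (0, -1)}

/-- The moves that bring a zombie at position `D` relative to the survivor closer to him. -/
def toward (D : ℤ × ℤ) : Finset (ℤ × ℤ) := {v ∈ unitVectors | v.1 * D.1 + v.2 * D.2 < 0}

lemma mem_unitVectors {v : ℤ × ℤ} :
    v ∈ unitVectors ↔ v = (1, 0) ∨ v = (-1, 0) ∨ v = (0, 1) ∨ v = (0, -1) := by
  simp [unitVectors]

lemma sum_unitVectors {α : Type*} [AddCommMonoid α] (f : ℤ × ℤ → α) :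
    ∑ v ∈ unitVectors, f v = f (1, 0) + (f (-1, 0) + (f (0, 1) + f (0, -1))) := by
  simp [unitVectors]

lemma mem_toward {v D : ℤ × ℤ} : v ∈ toward D ↔ v ∈ unitVectors ∧ v.1 * D.1 + v.2 * D.2 < 0 :=
  Finset.mem_filter

lemma card_toward {D : ℤ × ℤ} (hD : D ≠ 0) :
    (toward D).card = if D.1 = 0 ∨ D.2 = 0 then 1 else 2 := by
  obtain ⟨x, y⟩ := D
  rcases lt_trichotomy x 0 with hx | rfl | hx <;> rcases lt_trichotomy y 0 with hy | rfl | hy <;>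
    simp_all [toward, unitVectors, Finset.filter_insert, Finset.filter_singleton, not_lt_of_gt,
      ne_of_lt, ne_of_gt]

lemma toward_nonempty {D : ℤ × ℤ} (hD : D ≠ 0) : (toward D).Nonempty := by
  rw [← Finset.card_pos, card_toward hD]
  split_ifs <;> norm_num

lemma toward_zero : toward 0 = ∅ := by simp [toward]

lemma torus_adj_iff {n : ℕ} (hn : 2 ≤ n) (z w : Vertex n) :
    (torus n).Adj z w ↔ ∃ v ∈ unitVectors, w = z + red n v := by
  simp only [mem_unitVectors, or_and_right, exists_or, exists_eq_left]
  simp only [torus, SimpleGraph.boxProd_adj, cycle_adj_iff hn, red_apply, Prod.ext_iff,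
    Prod.fst_add, Prod.snd_add, Int.cast_zero, Int.cast_one, Int.cast_neg, add_zero,
    ← sub_eq_add_neg]
  tauto

lemma natAbs_add_unitVector_lt_iff {v D : ℤ × ℤ} (hv : v ∈ unitVectors) :
    (D + v).1.natAbs + (D + v).2.natAbs < D.1.natAbs + D.2.natAbs ↔
      v.1 * D.1 + v.2 * D.2 < 0 := by
  rw [mem_unitVectors] at hv
  rcases hv with rfl | rfl | rfl | rfl <;> simp only [Prod.fst_add, Prod.snd_add] <;> omega

lemma closer_add_red {n : ℕ} (s : Vertex n) {D : ℤ × ℤ} (h₁ : 2 * (|D.1| + 1) < n)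
    (h₂ : 2 * (|D.2| + 1) < n) :
    closer n s (s + red n D) = (fun v => s + red n (D + v)) '' toward D := by
  have hn : 2 ≤ n := by have := abs_nonneg D.1; omega
  have hcloser : ∀ v ∈ unitVectors, ((torus n).dist (s + red n (D + v)) s <
      (torus n).dist (s + red n D) s ↔ v.1 * D.1 + v.2 * D.2 < 0) := by
    intro v hv
    rw [← natAbs_add_unitVector_lt_iff hv, torus_dist_add_red s (D := D) (by omega) (by omega),
      torus_dist_add_red s]
    all_goals rw [mem_unitVectors] at hv; grind [Prod.fst_add, Prod.snd_add]
  ext w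
  simp only [closer, Set.mem_ofPred_eq, torus_adj_iff hn, Set.mem_image, Finset.mem_coe, mem_toward,
    add_assoc, ← map_add]
  constructor
  · rintro ⟨⟨v, hv, rfl⟩, h⟩
    exact ⟨v, ⟨hv, (hcloser v hv).1 h⟩, rfl⟩
  · rintro ⟨v, ⟨hv, h⟩, rfl⟩
    exact ⟨⟨v, hv, rfl⟩, (hcloser v hv).2 h⟩

lemma zombieStep_bind_apply_of_closer_eq {n : ℕ} {s z : Vertex n} {T : Finset (Vertex n)}
    (hT : closer n s z = T) (hne : T.Nonempty) {α : Type*} (F : Vertex n → PMF α) (a : α) :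
    (zombieStep n s z).bind F a = ∑ w ∈ T, (T.card : ENNReal)⁻¹ * F w a := by
  have hstep : zombieStep n s z = PMF.uniformOfFinset T hne := by
    rw [zombieStep, dif_pos (by simp [hT, hne])]
    simp only [hT, Finset.finite_toSet_toFinset]
  rw [hstep, PMF.bind_apply, tsum_eq_sum (s := T) fun w hw => by simp [hw]]
  exact Finset.sum_congr rfl fun w hw => by rw [PMF.uniformOfFinset_apply_of_mem hne hw]

/-- The probability that a zombie at position `D` relative to the survivor makes the move `v`. -/
noncomputable def stepProb (v D : ℤ × ℤ) : ℝ :=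
  if v ∈ toward D then ((toward D).card : ℝ)⁻¹ else 0

/-- The expected value of `h` after the random move of a zombie at relative position `D`. -/
noncomputable def zombieAvg (h : ℤ × ℤ → ENNReal) (D : ℤ × ℤ) : ENNReal :=
  ∑ v ∈ unitVectors, ENNReal.ofReal (stepProb v D) * h (D + v)

lemma stepProb_nonneg (v D : ℤ × ℤ) : 0 ≤ stepProb v D := by
  rw [stepProb]
  split_ifs <;> positivity

lemma stepProb_eq {v : ℤ × ℤ} (hv : v ∈ unitVectors) (D : ℤ × ℤ) :
    stepProb v D =
      if v.1 * D.1 + v.2 * D.2 < 0 then (if D.1 = 0 ∨ D.2 = 0 then 1 else 1 / 2) else 0 := by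
  rcases eq_or_ne D 0 with rfl | hD
  · simp [stepProb, toward_zero]
  · simp only [stepProb, mem_toward, hv, true_and, card_toward hD]
    split_ifs <;> norm_num

lemma zombieAvg_eq_sum_toward (h : ℤ × ℤ → ENNReal) (D : ℤ × ℤ) :
    zombieAvg h D = ∑ v ∈ toward D, ((toward D).card : ENNReal)⁻¹ * h (D + v) := by
  rw [zombieAvg, ← Finset.sum_subset (Finset.filter_subset _ _ : toward D ⊆ unitVectors)
    fun v _ (hv : v ∉ toward D) => by simp [stepProb, hv]]
  refine Finset.sum_congr rfl fun v hv => ?_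
  have hcard : (0 : ℝ) < (toward D).card := Nat.cast_pos.2 (Finset.card_pos.2 ⟨v, hv⟩)
  rw [stepProb, if_pos hv, ENNReal.ofReal_inv_of_pos hcard, ENNReal.ofReal_natCast]

lemma zombieAvg_congr {h h' : ℤ × ℤ → ENNReal} {D : ℤ × ℤ}
    (H : ∀ v ∈ toward D, h (D + v) = h' (D + v)) : zombieAvg h D = zombieAvg h' D := by
  rw [zombieAvg_eq_sum_toward, zombieAvg_eq_sum_toward]
  exact Finset.sum_congr rfl fun v hv => by rw [H v hv]

lemma zombieStep_bind_add_red {n : ℕ} (s : Vertex n) {D : ℤ × ℤ} (h₁ : 2 * (|D.1| + 1) < n)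
    (h₂ : 2 * (|D.2| + 1) < n) (hD : D ≠ 0) {α : Type*} (F : Vertex n → PMF α) (a : α) :
    (zombieStep n s (s + red n D)).bind F a = zombieAvg (fun E => F (s + red n E) a) D := by
  classical
  have hn : 2 < n := by
    contrapose! hD
    exact Prod.ext (abs_eq_zero.1 (by have := abs_nonneg D.1; omega))
      (abs_eq_zero.1 (by have := abs_nonneg D.2; omega))
  have hinj : Set.InjOn (fun v => s + red n (D + v)) (toward D) := by
    intro v hv w hw hvw
    rw [Finset.mem_coe, mem_toward, mem_unitVectors] at hv hw
    have hred : red n (v - w) = 0 := by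
      rw [map_sub, sub_eq_zero]
      simpa using hvw
    rw [red_eq_zero_iff] at hred
    · exact sub_eq_zero.1 hred
    all_goals rcases hv.1 with rfl | rfl | rfl | rfl <;> rcases hw.1 with rfl | rfl | rfl | rfl <;>
      simp <;> omega
  rw [zombieStep_bind_apply_of_closer_eq (T := (toward D).image fun v => s + red n (D + v))
    (by rw [closer_add_red s h₁ h₂, Finset.coe_image]) ((toward_nonempty hD).image _),
    Finset.sum_image hinj, Finset.card_image_of_injOn hinj, zombieAvg_eq_sum_toward]

/-- The number of moves of the zombies since the last move of the survivor, when the given side is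
to move. -/
def MovesFirst.phase : MovesFirst → ℕ
  | .zombies => 0
  | .survivor => 1

/-- The effect on the relative position of the zombies of a move of the survivor to the south,
followed by the exchange of the two coordinates. With this exchange his next move, to the west,
has the same description. -/
def flee : ℤ × ℤ ≃ ℤ × ℤ where
  toFun D := (D.2 + 1, D.1)
  invFun D := (D.2, D.1 - 1)
  left_inv D := by simp
  right_inv D := by simp

lemma flee_apply (D : ℤ × ℤ) : flee D = (D.2 + 1, D.1) := rfl

/-- The probability that a zombie at relative position `D` in the infinite grid eats the survivor,
who alternates between south and west, within the next `r` half-rounds, when `τ` is to move. -/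
noncomputable def hit : ℕ → MovesFirst → ℤ × ℤ → ENNReal
  | 0, _, D => if D = 0 then 1 else 0
  | r + 1, .zombies, D => if D = 0 then 1 else zombieAvg (hit r .survivor) D
  | r + 1, .survivor, D => if D = 0 then 1 else hit r .zombies (flee D)

lemma hit_apply_zero (r : ℕ) (τ : MovesFirst) : hit r τ 0 = 1 := by
  cases r <;> cases τ <;> simp [hit]

/-- The relative positions to the north-east of the survivor at distance at least `2` from him just
after his move, or at least `1` just after the move of the zombies. -/
def Behind (τ : MovesFirst) (D : ℤ × ℤ) : Prop :=
  0 ≤ D.1 ∧ 0 ≤ D.2 ∧ 2 ≤ D.1 + D.2 + τ.phase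

lemma Behind.ne_zero {τ : MovesFirst} {D : ℤ × ℤ} (h : Behind τ D) : D ≠ 0 := by
  rintro rfl
  cases τ <;> simp [Behind, MovesFirst.phase] at h

lemma Behind.flee {D : ℤ × ℤ} (h : Behind .survivor D) : Behind .zombies (flee D) := by
  simp only [Behind, MovesFirst.phase, flee_apply] at h ⊢
  omega

lemma Behind.step {v D : ℤ × ℤ} (h : Behind .zombies D) (hv : v ∈ toward D) :
    Behind .survivor (D + v) := by
  rw [mem_toward, mem_unitVectors] at hv
  simp only [Behind, MovesFirst.phase, Prod.fst_add, Prod.snd_add] at h ⊢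
  rcases hv with ⟨rfl | rfl | rfl | rfl, hv⟩ <;> simp only at hv <;> omega

lemma hit_eq_zero_of_behind (r : ℕ) {τ : MovesFirst} {D : ℤ × ℤ} (h : Behind τ D) :
    hit r τ D = 0 := by
  induction r generalizing τ D with
  | zero => rw [hit, if_neg h.ne_zero]
  | succ r ih =>
    cases τ with
    | zombies =>
      rw [hit, if_neg h.ne_zero, zombieAvg_eq_sum_toward]
      exact Finset.sum_eq_zero fun v hv => by rw [ih (h.step hv), mul_zero]
    | survivor => rw [hit, if_neg h.ne_zero, ih h.flee]

/-- The density of the zombies after a move of theirs, if it was `g` before. -/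
noncomputable def zombiePush (g : ℤ × ℤ → ℝ) (E : ℤ × ℤ) : ℝ :=
  ∑ v ∈ unitVectors, stepProb v (E - v) * g (E - v)

lemma tsum_mul_zombieAvg {g : ℤ × ℤ → ℝ} (hg : 0 ≤ g) (h : ℤ × ℤ → ENNReal) :
    ∑' D, ENNReal.ofReal (g D) * zombieAvg h D =
      ∑' E, ENNReal.ofReal (zombiePush g E) * h E := by
  have havg : ∀ D, ENNReal.ofReal (g D) * zombieAvg h D =
      ∑ v ∈ unitVectors, ENNReal.ofReal (stepProb v D * g D) * h (D + v) := fun D => by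
    rw [zombieAvg, Finset.mul_sum]
    refine Finset.sum_congr rfl fun v _ => ?_
    rw [ENNReal.ofReal_mul (stepProb_nonneg v D), ← mul_assoc, mul_comm (ENNReal.ofReal (g D))]
  have hpush : ∀ E, ENNReal.ofReal (zombiePush g E) * h E =
      ∑ v ∈ unitVectors, ENNReal.ofReal (stepProb v (E - v) * g (E - v)) * h E := fun E => by
    rw [zombiePush, ENNReal.ofReal_sum_of_nonneg fun v _ => mul_nonneg (stepProb_nonneg _ _) (hg _),
      Finset.sum_mul]
  simp only [havg, hpush, Summable.tsum_finsetSum fun _ _ => ENNReal.summable]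
  refine Finset.sum_congr rfl fun v _ => ?_
  rw [← (Equiv.addRight v).tsum_eq
    fun E => ENNReal.ofReal (stepProb v (E - v) * g (E - v)) * h E]
  simp only [Equiv.coe_addRight, add_sub_cancel_right]

lemma sum_unitVectors_swap {α : Type*} [AddCommMonoid α] (f : ℤ × ℤ → α) :
    ∑ v ∈ unitVectors, f v.swap = ∑ v ∈ unitVectors, f v := by
  simp only [sum_unitVectors, Prod.swap_prod_mk]
  abel

lemma stepProb_swap {v : ℤ × ℤ} (hv : v ∈ unitVectors) (D : ℤ × ℤ) :
    stepProb v.swap D.swap = stepProb v D := by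
  have hv' : v.swap ∈ unitVectors := by
    rw [mem_unitVectors] at hv ⊢
    rcases hv with rfl | rfl | rfl | rfl <;> simp
  simp only [stepProb_eq hv, stepProb_eq hv', Prod.fst_swap, Prod.snd_swap, or_comm,
    add_comm]

lemma zombieAvg_swap (h : ℤ × ℤ → ENNReal) (D : ℤ × ℤ) :
    zombieAvg h D.swap = zombieAvg (fun E => h E.swap) D := by
  rw [zombieAvg, zombieAvg, ← sum_unitVectors_swap]
  exact Finset.sum_congr rfl fun v hv => by rw [stepProb_swap hv, ← Prod.swap_add]

lemma zombiePush_swap (g : ℤ × ℤ → ℝ) (E : ℤ × ℤ) :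
    zombiePush g E.swap = zombiePush (fun D => g D.swap) E := by
  rw [zombiePush, zombiePush, ← sum_unitVectors_swap]
  exact Finset.sum_congr rfl fun v hv => by rw [← Prod.swap_sub, stepProb_swap hv]

/-- The expected number of zombies that eat the survivor within `r` half-rounds, if their initial
density is `g` and `τ` is to move. -/
noncomputable def eaten (g : ℤ × ℤ → ℝ) (τ : MovesFirst) (r : ℕ) : ENNReal :=
  ∑' D, ENNReal.ofReal (g D) * hit r τ D

lemma eaten_zero (g : ℤ × ℤ → ℝ) (τ : MovesFirst) : eaten g τ 0 = ENNReal.ofReal (g 0) := by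
  rw [eaten, tsum_eq_single 0 fun D hD => by rw [hit, if_neg hD, mul_zero], hit_apply_zero,
    mul_one]

lemma eaten_eq_add_tsum (g : ℤ × ℤ → ℝ) (τ : MovesFirst) (r : ℕ) :
    eaten g τ r = ENNReal.ofReal (g 0) +
      ∑' D, if D = 0 then 0 else ENNReal.ofReal (g D) * hit r τ D := by
  rw [eaten, ENNReal.tsum_eq_add_tsum_ite 0, hit_apply_zero, mul_one]
  congr!

lemma ofReal_mul_hit_mono {a b : ℝ} (r : ℕ) {τ : MovesFirst} {D : ℤ × ℤ}
    (h : ¬ Behind τ D → a ≤ b) : ENNReal.ofReal a * hit r τ D ≤ ENNReal.ofReal b * hit r τ D := by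
  by_cases hD : Behind τ D
  · rw [hit_eq_zero_of_behind r hD, mul_zero, mul_zero]
  · gcongr
    exact h hD

lemma eaten_zombies_succ_le {g g' : ℤ × ℤ → ℝ} (hg : 0 ≤ g)
    (H : ∀ D, ¬ Behind .survivor D → zombiePush g D ≤ g' D) (r : ℕ) :
    eaten g .zombies (r + 1) ≤ ENNReal.ofReal (g 0) + eaten g' .survivor r := by
  rw [eaten_eq_add_tsum]
  refine add_le_add_right ?_ _
  calc ∑' D, (if D = 0 then 0 else ENNReal.ofReal (g D) * hit (r + 1) .zombies D)
      ≤ ∑' D, ENNReal.ofReal (g D) * zombieAvg (hit r .survivor) D :=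
        ENNReal.tsum_le_tsum fun D => by
          split_ifs with hD
          · exact zero_le
          · rw [hit, if_neg hD]
    _ = ∑' E, ENNReal.ofReal (zombiePush g E) * hit r .survivor E := tsum_mul_zombieAvg hg _
    _ ≤ eaten g' .survivor r := ENNReal.tsum_le_tsum fun E => ofReal_mul_hit_mono r (H E)

lemma eaten_survivor_succ_le {g g' : ℤ × ℤ → ℝ}
    (H : ∀ D ≠ 0, ¬ Behind .zombies (flee D) → g D ≤ g' (flee D)) (r : ℕ) :
    eaten g .survivor (r + 1) ≤ ENNReal.ofReal (g 0) + eaten g' .zombies r := by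
  rw [eaten_eq_add_tsum]
  refine add_le_add_right ?_ _
  calc ∑' D, (if D = 0 then 0 else ENNReal.ofReal (g D) * hit (r + 1) .survivor D)
      ≤ ∑' D, ENNReal.ofReal (g' (flee D)) * hit r .zombies (flee D) :=
        ENNReal.tsum_le_tsum fun D => by
          split_ifs with hD
          · exact zero_le
          · rw [hit, if_neg hD]
            exact ofReal_mul_hit_mono r (H D hD)
    _ = eaten g' .zombies r := flee.tsum_eq fun E => ENNReal.ofReal (g' E) * hit r .zombies E

/-- A solution of the heat equation, decreasing in `u` up to `u = 2 * a`, that bounds the density of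
the zombies near the two axes; `z` is the number of moves of the zombies so far. -/
noncomputable def bulk (a : ℝ) (z : ℕ) (u : ℤ) : ℝ := 1 + (z + (2 * a - u) ^ 2) / a

section Density

variable {a : ℝ}

lemma bulk_add_bulk (z : ℕ) (u : ℤ) :
    1 / 2 * bulk a z u + 1 / 2 * bulk a z (u + 2) = bulk a (z + 1) (u + 1) := by
  simp only [bulk]
  push_cast
  ring

lemma bulk_one_add_four (ha : 0 < a) (z : ℕ) : bulk a z 1 + 4 = bulk a (z + 1) 0 := by
  simp only [bulk]
  push_cast
  field_simp
  ring

lemma one_le_bulk (ha : 0 < a) (z : ℕ) (u : ℤ) : 1 ≤ bulk a z u := by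
  rw [bulk]
  have : 0 ≤ (z + (2 * a - u) ^ 2) / a := by positivity
  linarith

lemma bulk_mono (ha : 0 < a) {z z' : ℕ} (hz : z ≤ z') (u : ℤ) : bulk a z u ≤ bulk a z' u := by
  simp only [bulk]
  gcongr

lemma bulk_le_bulk_zero (ha : 0 < a) (z : ℕ) {u : ℤ} (hu : 0 ≤ u) (hua : u ≤ 4 * a) :
    bulk a z u ≤ bulk a z 0 := by
  have hu' : (0 : ℝ) ≤ u := by exact_mod_cast hu
  simp only [bulk]
  gcongr 1 + (_ + ?_) / _
  push_cast
  nlinarith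

lemma three_le_bulk_zero (ha : 1 ≤ a) (z : ℕ) : 3 ≤ bulk a z 0 := by
  have hpos : 0 < a := by linarith
  have : 2 ≤ (z + (2 * a) ^ 2) / a := by
    rw [le_div_iff₀ hpos]
    nlinarith [(Nat.cast_nonneg z : (0 : ℝ) ≤ z)]
  simp only [bulk, Int.cast_zero, sub_zero]
  linarith

/-- The density bound on a line parallel to an axis, on the side the survivor is moving away to,
for zombies at coordinate `x` on the line: there `m = 2 * x + δ`, where `δ` is the number of moves
of the zombies since the survivor last moved along the line. -/
noncomputable def profile (a : ℝ) (z : ℕ) (m : ℤ) : ℝ :=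
  if m ≤ 0 then 1 else if m = 1 then (bulk a z 0 - 1) / 2 else bulk a z (m - 1)

lemma one_le_profile (ha : 1 ≤ a) (z : ℕ) (m : ℤ) : 1 ≤ profile a z m := by
  rw [profile]
  split_ifs
  · exact le_rfl
  · linarith [three_le_bulk_zero ha z]
  · exact one_le_bulk (by linarith) z _

lemma profile_le_bulk_zero (ha : 1 ≤ a) (z : ℕ) {m : ℤ} (hm : m ≤ 4) :
    profile a z m ≤ bulk a z 0 := by
  have hpos : 0 < a := by linarith
  rw [profile]
  split_ifs
  · exact one_le_bulk hpos z 0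
  · linarith [one_le_bulk hpos z 0]
  · have hm' : (m : ℝ) ≤ 4 := by exact_mod_cast hm
    refine bulk_le_bulk_zero hpos z (by omega) ?_
    push_cast
    linarith

/-- The effect of a move of the zombies on a density `p` that depends only on the coordinate `x`,
on a half-plane whose points have the other coordinate negative. -/
noncomputable def linePush (p : ℤ → ℝ) (x : ℤ) : ℝ :=
  if x < 0 then 1 / 2 * p (x - 1) + 1 / 2 * p x
  else if x = 0 then 1 / 2 * p (x - 1) + p x + 1 / 2 * p (x + 1)
  else 1 / 2 * p x + 1 / 2 * p (x + 1)

lemma linePush_profile (ha : 0 < a) (z : ℕ) {δ : ℕ} (hδ : δ ≤ 1) (x : ℤ) :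
    linePush (fun x => profile a z (2 * x + δ)) x =
      profile a (z + 1) (2 * x + (δ + 1 : ℕ)) := by
  rw [linePush]
  rcases lt_trichotomy x 0 with hx | rfl | hx
  · simp only [profile, hx, if_true]
    rw [if_pos (by omega), if_pos (by omega), if_pos (by omega)]
    norm_num
  · interval_cases δ
    · have hnear := bulk_one_add_four ha z
      norm_num only [profile, if_true, if_false]
      linarith
    · have hheat := bulk_add_bulk (a := a) z 0
      norm_num only [profile, if_true, if_false] at hheat ⊢
      linarith
  · have hheat := bulk_add_bulk (a := a) z (2 * x + δ - 1)
    simp only [profile, not_lt_of_gt hx, hx.ne', if_false]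
    rw [if_neg (by omega), if_neg (by omega), if_neg (by omega), if_neg (by omega),
      if_neg (by omega), if_neg (by omega)]
    convert hheat using 4 <;> push_cast <;> ring

lemma zombiePush_of_snd_neg {g : ℤ × ℤ → ℝ} {p : ℤ → ℝ} (hg : ∀ x y, y < 0 → g (x, y) = p x)
    {x y : ℤ} (hy : y < 0) : zombiePush g (x, y) = linePush p x := by
  have hmem := fun v => (mem_unitVectors (v := v)).2
  simp only [zombiePush, sum_unitVectors, stepProb_eq, hmem, true_or, or_true, Prod.mk_sub_mk,
    sub_zero, sub_neg_eq_add, linePush]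
  rw [hg _ _ hy, hg _ _ hy, hg _ (y - 1) (by omega)]
  grind

/-- The supersolution: a bound for the density of the zombies at relative position `D`, when there
was density at most `1` everywhere `z` moves of the zombies ago. Its values on the quadrant of
the zombies behind the survivor matter only next to the survivor. -/
noncomputable def density (a : ℝ) (τ : MovesFirst) (z : ℕ) (D : ℤ × ℤ) : ℝ :=
  if D.2 < 0 then profile a z (2 * D.1 + τ.phase)
  else if D.1 < 0 then profile a z (2 * D.2 + (τ.phase + 1 : ℕ))
  else if D = 0 then 4 * bulk a z 0 else bulk a z 0

lemma MovesFirst.phase_le_one (τ : MovesFirst) : τ.phase ≤ 1 := by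
  cases τ <;> simp [MovesFirst.phase]

lemma density_of_snd_neg (τ : MovesFirst) (z : ℕ) {D : ℤ × ℤ} (h : D.2 < 0) :
    density a τ z D = profile a z (2 * D.1 + τ.phase) := if_pos h

lemma density_of_fst_neg (τ : MovesFirst) (z : ℕ) {D : ℤ × ℤ} (h : D.1 < 0) :
    density a τ z D = profile a z (2 * D.2 + (τ.phase + 1 : ℕ)) := by
  have := τ.phase_le_one
  rw [density, if_pos h]
  split_ifs with h₂
  · rw [profile, profile, if_pos (by omega), if_pos (by omega)]
  · rfl

lemma density_zero (τ : MovesFirst) (z : ℕ) : density a τ z 0 = 4 * bulk a z 0 := by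
  simp [density]

lemma bulk_zero_le_density (ha : 0 < a) (τ : MovesFirst) (z : ℕ) {D : ℤ × ℤ} (h₁ : 0 ≤ D.1)
    (h₂ : 0 ≤ D.2) : bulk a z 0 ≤ density a τ z D := by
  rw [density, if_neg h₂.not_gt, if_neg h₁.not_gt]
  split_ifs
  · linarith [one_le_bulk ha z 0]
  · rfl

lemma one_le_density (ha : 1 ≤ a) (τ : MovesFirst) (z : ℕ) (D : ℤ × ℤ) : 1 ≤ density a τ z D := by
  have hpos : 0 < a := by linarith
  rcases lt_or_ge D.2 0 with h₂ | h₂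
  · exact (one_le_profile ha z _).trans_eq (density_of_snd_neg τ z h₂).symm
  rcases lt_or_ge D.1 0 with h₁ | h₁
  · exact (one_le_profile ha z _).trans_eq (density_of_fst_neg τ z h₁).symm
  · exact (one_le_bulk hpos z 0).trans (bulk_zero_le_density hpos τ z h₁ h₂)

lemma density_le_bulk_zero (ha : 1 ≤ a) (z : ℕ) {v : ℤ × ℤ} (hv : v ∈ unitVectors) :
    density a .zombies z v ≤ bulk a z 0 := by
  have hprofile : ∀ m ≤ 4, profile a z m ≤ bulk a z 0 := fun _ => profile_le_bulk_zero ha z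
  rw [mem_unitVectors] at hv
  rcases hv with rfl | rfl | rfl | rfl
  · simp [density]
  · exact (density_of_fst_neg _ z (by simp)).trans_le (hprofile _ (by simp [MovesFirst.phase]))
  · simp [density]
  · exact (density_of_snd_neg _ z (by simp)).trans_le (hprofile _ (by simp [MovesFirst.phase]))

lemma zombiePush_apply_zero_le (g : ℤ × ℤ → ℝ) {b : ℝ} (hb : ∀ v ∈ unitVectors, g v ≤ b) :
    zombiePush g 0 ≤ 4 * b := by
  have hstep : ∀ v ∈ unitVectors, stepProb v (0 - v) * g (0 - v) ≤ b := by
    intro v hv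
    have hneg : 0 - v ∈ unitVectors := by
      rw [mem_unitVectors] at hv ⊢
      rcases hv with rfl | rfl | rfl | rfl <;> simp
    have hone : stepProb v (0 - v) = 1 := by
      rw [stepProb_eq hv]
      rw [mem_unitVectors] at hv
      rcases hv with rfl | rfl | rfl | rfl <;> simp
    rw [hone, one_mul]
    exact hb _ hneg
  simpa [zombiePush, unitVectors] using Finset.sum_le_card_nsmul _ _ _ hstep

lemma zombiePush_density_le (ha : 1 ≤ a) (z : ℕ) {D : ℤ × ℤ} (hD : ¬ Behind .survivor D) :
    zombiePush (density a .zombies z) D ≤ density a .survivor (z + 1) D := by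
  have hpos : 0 < a := by linarith
  obtain ⟨x, y⟩ := D
  rcases lt_or_ge y 0 with hy | hy
  · rw [zombiePush_of_snd_neg (p := fun x => profile a z (2 * x + (0 : ℕ)))
        (fun x y hy => density_of_snd_neg _ z hy) hy,
      density_of_snd_neg _ _ hy, linePush_profile hpos z zero_le_one]
    rfl
  rcases lt_or_ge x 0 with hx | hx
  · rw [← Prod.swap_prod_mk, zombiePush_swap,
      zombiePush_of_snd_neg (p := fun y => profile a z (2 * y + (1 : ℕ)))
        (fun y x hx => density_of_fst_neg _ z hx) hx,
      density_of_fst_neg _ _ hx]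
    exact (linePush_profile hpos z le_rfl y).le
  · obtain ⟨rfl, rfl⟩ : x = 0 ∧ y = 0 := by
      simp only [Behind, MovesFirst.phase] at hD
      omega
    calc zombiePush (density a .zombies z) 0
        ≤ 4 * bulk a z 0 := zombiePush_apply_zero_le _ fun v hv => density_le_bulk_zero ha z hv
      _ ≤ 4 * bulk a (z + 1) 0 := by gcongr; exact bulk_mono hpos z.le_succ 0
      _ = density a .survivor (z + 1) 0 := (density_zero _ _).symm

lemma density_le_density_flee (ha : 1 ≤ a) (z : ℕ) {D : ℤ × ℤ} (h₀ : D ≠ 0)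
    (hD : ¬ Behind .zombies (flee D)) :
    density a .survivor z D ≤ density a .zombies z (flee D) := by
  rcases lt_or_ge D.1 0 with h₁ | h₁
  · rw [density_of_fst_neg _ z h₁, density_of_snd_neg _ z (by exact h₁)]
    apply le_of_eq
    congr 1
    simp only [flee_apply, MovesFirst.phase]
    push_cast
    ring
  rcases lt_or_ge (D.2 + 1) 0 with h₂ | h₂
  · rw [density_of_snd_neg _ z (by omega), density_of_fst_neg _ z (by exact h₂)]
    rfl
  · have hD' : D.2 < 0 ∧ D.1 ≤ 1 := by
      rw [Ne, Prod.ext_iff] at h₀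
      simp only [Behind, MovesFirst.phase, flee_apply] at hD
      simp only [Prod.fst_zero, Prod.snd_zero] at h₀
      omega
    calc density a .survivor z D = profile a z (2 * D.1 + 1) := density_of_snd_neg _ z hD'.1
      _ ≤ bulk a z 0 := profile_le_bulk_zero ha z (by omega)
      _ ≤ density a .zombies z (flee D) :=
        bulk_zero_le_density (by linarith) _ z (by exact h₂) (by exact h₁)

lemma eaten_density_le (ha : 1 ≤ a) (r : ℕ) (τ : MovesFirst) (z : ℕ) :
    eaten (density a τ z) τ r ≤ (r + 1) * ENNReal.ofReal (4 * bulk a (z + r) 0) := by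
  have hpos : 0 < a := by linarith
  induction r generalizing τ z with
  | zero => rw [eaten_zero, density_zero]; simp
  | succ r ih =>
    have hzero : ENNReal.ofReal (density a τ z 0) ≤
        ENNReal.ofReal (4 * bulk a (z + (r + 1)) 0) := by
      rw [density_zero]
      gcongr
      exact bulk_mono hpos (by omega) 0
    rw [Nat.cast_succ, add_mul _ 1, one_mul, add_comm (_ * _)]
    cases τ with
    | zombies =>
      refine (eaten_zombies_succ_le (fun D => zero_le_one.trans (one_le_density ha _ z D))
        (fun D => zombiePush_density_le ha z) r).trans (add_le_add hzero ?_)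
      simpa only [add_right_comm z 1 r, add_assoc] using ih .survivor (z + 1)
    | survivor =>
      refine (eaten_survivor_succ_le (fun D => density_le_density_flee ha z) r).trans
        (add_le_add hzero ((ih .zombies z).trans ?_))
      gcongr
      exact bulk_mono hpos (by omega) 0

lemma tsum_hit_le (ha : 1 ≤ a) (r : ℕ) (τ : MovesFirst) :
    ∑' D, hit r τ D ≤ (r + 1) * ENNReal.ofReal (4 * bulk a r 0) := by
  calc ∑' D, hit r τ D
      ≤ eaten (density a τ 0) τ r := ENNReal.tsum_le_tsum fun D =>
        le_mul_of_one_le_left' (ENNReal.one_le_ofReal.2 (one_le_density ha τ 0 D))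
    _ ≤ _ := by simpa using eaten_density_le ha r τ 0

end Density

lemma play_self (τ : MovesFirst) (n : ℕ) (l : List Move) (s : Vertex n) :
    play τ n l s s = PMF.pure true := by
  cases l <;> simp [play]

lemma play_zombies_cons {n : ℕ} (m : Move) (l : List Move) {s z : Vertex n} (h : z ≠ s) :
    play .zombies n (m :: l) s z = (zombieStep n s z).bind fun w =>
      if w = s then PMF.pure true else play .zombies n l (s + m.vec n) w := by
  rw [play, if_neg h]

lemma play_survivor_cons {n : ℕ} (m : Move) (l : List Move) {s z : Vertex n} (h : z ≠ s) :
    play .survivor n (m :: l) s z =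
      (zombieStep n (s + m.vec n) z).bind fun w => play .survivor n l (s + m.vec n) w := by
  rw [play, if_neg h]

lemma zombieStep_self (n : ℕ) (s : Vertex n) : zombieStep n s s = PMF.pure s := by
  rw [zombieStep, dif_neg]
  rintro ⟨-, w, hw⟩
  simp [closer] at hw

/-- The `i`-th move of the diagonal strategy, counted from `0`. -/
def zigzag (i : ℕ) : Move := if i % 2 = 0 then .south else .west

/-- The displacement on the torus that is described by the relative position `D` once the
coordinates have been exchanged `j` times. -/
def frame (n j : ℕ) (D : ℤ × ℤ) : Vertex n := red n (if j % 2 = 0 then D else D.swap)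

section Frame

variable {n : ℕ}

lemma frame_succ_flee (j : ℕ) (D : ℤ × ℤ) :
    (zigzag j).vec n + frame n (j + 1) (flee D) = frame n j D := by
  rcases Nat.mod_two_eq_zero_or_one j with hj | hj <;>
    simp [frame, zigzag, Move.vec, red_apply, flee_apply, Nat.add_mod, hj]

lemma frame_eq_zero_iff (j : ℕ) {D : ℤ × ℤ} (h₁ : |D.1| < n) (h₂ : |D.2| < n) :
    frame n j D = 0 ↔ D = 0 := by
  rw [frame]
  split_ifs
  · exact red_eq_zero_iff h₁ h₂
  · rw [red_eq_zero_iff h₂ h₁, ← Prod.swap_inj, Prod.swap_swap]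
    rfl

lemma zombieStep_bind_add_frame (s : Vertex n) (j : ℕ) {D : ℤ × ℤ} (h₁ : 2 * (|D.1| + 1) < n)
    (h₂ : 2 * (|D.2| + 1) < n) (hD : D ≠ 0) {α : Type*} (F : Vertex n → PMF α) (a : α) :
    (zombieStep n s (s + frame n j D)).bind F a =
      zombieAvg (fun E => F (s + frame n j E) a) D := by
  simp only [frame]
  split_ifs
  · exact zombieStep_bind_add_red s h₁ h₂ hD F a
  · have hswap : D.swap ≠ 0 := fun h => hD (by simpa using congrArg Prod.swap h)
    rw [zombieStep_bind_add_red s (D := D.swap) h₂ h₁ hswap, zombieAvg_swap]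

/-- A relative position from which `r` more rounds do not leave the square of radius `K`. -/
def Within (K : ℤ) (r : ℕ) (D : ℤ × ℤ) : Prop :=
  r ≤ K ∧ -K ≤ D.1 ∧ D.1 + r ≤ K ∧ -K ≤ D.2 ∧ D.2 + r ≤ K

lemma Within.two_mul_lt {K : ℤ} {r : ℕ} {D : ℤ × ℤ} (h : Within K r D) (hK : 2 * (K + 1) < n) :
    2 * (|D.1| + 1) < n ∧ 2 * (|D.2| + 1) < n := by
  obtain ⟨-, hl₁, hu₁, hl₂, hu₂⟩ := h
  have h₁ := abs_le.2 ⟨hl₁, (by omega : D.1 ≤ K)⟩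
  have h₂ := abs_le.2 ⟨hl₂, (by omega : D.2 ≤ K)⟩
  omega

lemma Within.step {K : ℤ} {r : ℕ} {D v : ℤ × ℤ} (h : Within K r D) (hv : v ∈ toward D) :
    Within K r (D + v) := by
  rw [mem_toward, mem_unitVectors] at hv
  simp only [Within, Prod.fst_add, Prod.snd_add] at h ⊢
  rcases hv with ⟨rfl | rfl | rfl | rfl, hv⟩ <;> simp only at hv <;> omega

lemma Within.flee {K : ℤ} {r : ℕ} {D : ℤ × ℤ} (h : Within K (r + 1) D) :
    Within K r (flee D) := by
  simp only [Within, flee_apply] at h ⊢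
  omega

lemma Within.add_frame_eq_iff {K : ℤ} {r : ℕ} {D : ℤ × ℤ} (h : Within K r D)
    (hK : 2 * (K + 1) < n) (s : Vertex n) (j : ℕ) : s + frame n j D = s ↔ D = 0 := by
  obtain ⟨h₁, h₂⟩ := h.two_mul_lt hK
  have := abs_nonneg D.1
  have := abs_nonneg D.2
  rw [add_eq_left, frame_eq_zero_iff j (by omega) (by omega)]

lemma play_zombies_zigzag_cons {K : ℤ} (hK : 2 * (K + 1) < n) {r j : ℕ} {l : List Move}
    {s : Vertex n} {D : ℤ × ℤ} (h : Within K (r + 1) D) (h₀ : D ≠ 0)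
    (ih : ∀ E, Within K r E → play .zombies n l (s + (zigzag j).vec n)
      (s + (zigzag j).vec n + frame n (j + 1) E) true = hit (2 * r) .zombies E) :
    play .zombies n (zigzag j :: l) s (s + frame n j D) true = hit (2 * r + 2) .zombies D := by
  obtain ⟨h₁, h₂⟩ := h.two_mul_lt hK
  rw [play_zombies_cons _ _ (by rwa [Ne, h.add_frame_eq_iff hK]),
    zombieStep_bind_add_frame s j h₁ h₂ h₀, hit, if_neg h₀]
  refine zombieAvg_congr fun v hv => ?_
  simp only [hit, (h.step hv).add_frame_eq_iff hK]
  split_ifs with hv₀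
  · exact PMF.pure_apply_self true
  · rw [← ih _ (h.step hv).flee, add_assoc, frame_succ_flee]

lemma play_survivor_zigzag_cons {K : ℤ} (hK : 2 * (K + 1) < n) {r j : ℕ} {l : List Move}
    {s : Vertex n} {D : ℤ × ℤ} (h : Within K (r + 1) D) (h₀ : D ≠ 0)
    (ih : ∀ E, Within K r E → play .survivor n l (s + (zigzag j).vec n)
      (s + (zigzag j).vec n + frame n (j + 1) E) true = hit (2 * r) .survivor E) :
    play .survivor n (zigzag j :: l) s (s + frame n j D) true = hit (2 * r + 2) .survivor D := by
  rw [play_survivor_cons _ _ (by rwa [Ne, h.add_frame_eq_iff hK]), hit, if_neg h₀,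
    ← frame_succ_flee, ← add_assoc]
  obtain ⟨h₁, h₂⟩ := h.flee.two_mul_lt hK
  rcases eq_or_ne (flee D) 0 with hflee | hflee
  · rw [h.flee.add_frame_eq_iff hK _ (j + 1) |>.2 hflee, zombieStep_self, PMF.pure_bind, play_self,
      hflee, hit_apply_zero, PMF.pure_apply_self]
  · rw [zombieStep_bind_add_frame _ _ h₁ h₂ hflee, hit, if_neg hflee]
    exact zombieAvg_congr fun v hv => ih _ (h.flee.step hv)

lemma play_zigzag (τ : MovesFirst) {K : ℤ} (hK : 2 * (K + 1) < n) {r : ℕ} (j : ℕ) (s : Vertex n)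
    {D : ℤ × ℤ} (h : Within K r D) :
    play τ n ((List.range' j r).map zigzag) s (s + frame n j D) true = hit (2 * r) τ D := by
  induction r generalizing j s D with
  | zero =>
    simp only [List.range'_zero, List.map_nil, play, hit, h.add_frame_eq_iff hK]
    by_cases h₀ : D = 0 <;> simp [h₀]
  | succ r ih =>
    rcases eq_or_ne D 0 with rfl | h₀
    · rw [h.add_frame_eq_iff hK s j |>.2 rfl, play_self, hit_apply_zero, PMF.pure_apply_self]
    · rw [List.range'_succ, List.map_cons]
      cases τ with
      | zombies => exact play_zombies_zigzag_cons hK h h₀ fun E => ih (j + 1) _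
      | survivor => exact play_survivor_zigzag_cons hK h h₀ fun E => ih (j + 1) _

end Frame

/-- The displacement of the survivor in the infinite grid caused by a move. -/
def Move.disp : Move → ℤ × ℤ
  | .west => (-1, 0)
  | .east => (1, 0)
  | .north => (0, 1)
  | .south => (0, -1)
  | .stay => (0, 0)

lemma Move.red_disp (n : ℕ) (m : Move) : red n m.disp = m.vec n := by
  cases m <;> simp [Move.vec, Move.disp, red_apply]

lemma Move.abs_disp_le_one (m : Move) : |m.disp.1| ≤ 1 ∧ |m.disp.2| ≤ 1 := by
  cases m <;> simp [Move.disp]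

lemma Strategy.final_eq {n : ℕ} (S : Strategy n) :
    S.final = S.start + red n (∑ i, (S.move i).disp) := by
  simp only [Strategy.final, map_sum, Move.red_disp]

lemma sum_disp_zigzag (r : ℕ) : ∑ i ∈ Finset.range r, (zigzag i).disp =
    -(((r / 2 : ℕ) : ℤ), (((r + 1) / 2 : ℕ) : ℤ)) := by
  induction r with
  | zero => rfl
  | succ r ih =>
    rw [Finset.sum_range_succ, ih, zigzag]
    split_ifs <;> ext <;> simp [Move.disp] <;> omega

lemma diagonal_start (n : ℕ) : (diagonal n).start =
    red n (((rounds n / 2 : ℕ) : ℤ), (((rounds n + 1) / 2 : ℕ) : ℤ)) := by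
  simp only [diagonal, red_apply, Int.cast_natCast]

lemma diagonal_final (n : ℕ) : (diagonal n).final = 0 := by
  have hsum : ∑ i, ((diagonal n).move i).disp = ∑ i ∈ Finset.range (rounds n), (zigzag i).disp :=
    Fin.sum_univ_eq_sum_range (fun i => (zigzag i).disp) _
  rw [Strategy.final_eq, hsum, sum_disp_zigzag, diagonal_start, ← map_add, add_neg_cancel, map_zero]

lemma ofFn_diagonal_move (n : ℕ) :
    List.ofFn (diagonal n).move = (List.range' 0 (rounds n)).map zigzag :=
  List.ext_getElem (by simp) (by simp [diagonal, zigzag])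

lemma eatProb_nonneg (τ : MovesFirst) {n : ℕ} (S : Strategy n) (x y : ℤ) : 0 ≤ eatProb τ S x y :=
  ENNReal.toReal_nonneg

lemma ofReal_eatProb_diagonal (τ : MovesFirst) {n : ℕ} (hn : 13 ≤ n) {x y : ℤ}
    (hx : x ∈ Finset.Icc (-(rounds n : ℤ)) (rounds n))
    (hy : y ∈ Finset.Icc (-(rounds n : ℤ)) (rounds n)) :
    ENNReal.ofReal (eatProb τ (diagonal n) x y) = hit (2 * rounds n) τ
      ((x, y) - (((rounds n / 2 : ℕ) : ℤ), (((rounds n + 1) / 2 : ℕ) : ℤ))) := by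
  have hM : rounds n = n / 4 := rfl
  rw [Finset.mem_Icc] at hx hy
  rw [← play_zigzag τ (n := n) (K := rounds n + ((rounds n + 1) / 2 : ℕ)) (by omega) 0
    (diagonal n).start, eatProb, ENNReal.ofReal_toReal (PMF.apply_ne_top _ _), ofFn_diagonal_move]
  · congr 2
    rw [diagonal_start, frame, if_pos rfl, ← map_add, add_sub_cancel, diagonal_final, zero_add,
      red_apply]
  · simp only [Within, Prod.mk_sub_mk]
    omega

lemma ofReal_weight_diagonal_le (τ : MovesFirst) {n : ℕ} (hn : 13 ≤ n) :
    ENNReal.ofReal (weight τ (diagonal n)) ≤ ∑' D, hit (2 * rounds n) τ D := by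
  set c : ℤ × ℤ := (((rounds n / 2 : ℕ) : ℤ), (((rounds n + 1) / 2 : ℕ) : ℤ))
  set box := Finset.Icc (-(rounds n : ℤ)) (rounds n)
  calc ENNReal.ofReal (weight τ (diagonal n))
      = ∑ q ∈ box ×ˢ box, ENNReal.ofReal (eatProb τ (diagonal n) q.1 q.2) := by
        rw [← ENNReal.ofReal_sum_of_nonneg fun q _ => eatProb_nonneg _ _ _ _, Finset.sum_product]
        rfl
    _ = ∑ q ∈ box ×ˢ box, hit (2 * rounds n) τ (q - c) :=
        Finset.sum_congr rfl fun q hq =>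
          ofReal_eatProb_diagonal τ hn (Finset.mem_product.1 hq).1 (Finset.mem_product.1 hq).2
    _ ≤ ∑' q, hit (2 * rounds n) τ (q - c) := ENNReal.sum_le_tsum _
    _ = ∑' D, hit (2 * rounds n) τ D := (Equiv.subRight c).tsum_eq (hit (2 * rounds n) τ)

lemma natCast_rpow_three_halves (n : ℕ) : (n : ℝ) ^ (3 / 2 : ℝ) = n * √n := by
  rw [show (3 / 2 : ℝ) = 1 + 1 / 2 by norm_num, Real.rpow_add_of_nonneg n.cast_nonneg zero_le_one
    (by norm_num), Real.rpow_one, Real.sqrt_eq_rpow]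

lemma weight_diagonal_le (τ : MovesFirst) {n : ℕ} (hn : 13 ≤ n) :
    weight τ (diagonal n) ≤ 22 * (n : ℝ) ^ (3 / 2 : ℝ) := by
  have hn' : (13 : ℝ) ≤ n := by exact_mod_cast hn
  have hM : (4 : ℝ) * rounds n ≤ n := by exact_mod_cast (show 4 * (n / 4) ≤ n by omega)
  have hsq : √(n : ℝ) ^ 2 = n := Real.sq_sqrt n.cast_nonneg
  have hone : 1 ≤ √(n : ℝ) := Real.one_le_sqrt.2 (by linarith)
  have hbulk : 4 * bulk (√n) (2 * rounds n) 0 ≤ 22 * √n := by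
    have : (2 * rounds n + (2 * √n) ^ 2) / √n ≤ 9 / 2 * √n := by
      rw [div_le_iff₀ (by linarith), mul_assoc, ← sq, mul_pow, hsq]
      linarith
    rw [bulk]
    push_cast
    rw [sub_zero]
    linarith
  rw [natCast_rpow_three_halves, ← ENNReal.ofReal_le_ofReal_iff (by positivity)]
  calc ENNReal.ofReal (weight τ (diagonal n))
      ≤ ((2 * rounds n : ℕ) + 1) * ENNReal.ofReal (4 * bulk (√n) (2 * rounds n) 0) :=
        (ofReal_weight_diagonal_le τ hn).trans (tsum_hit_le hone _ τ)
    _ ≤ n * ENNReal.ofReal (22 * √n) := by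
        gcongr
        exact_mod_cast (show 2 * (n / 4) + 1 ≤ n by omega)
    _ = ENNReal.ofReal (22 * (n * √n)) := by
        rw [← ENNReal.ofReal_natCast, ← ENNReal.ofReal_mul n.cast_nonneg, mul_left_comm]

lemma neg_sum_mem_Icc {m : ℕ} {f : Fin m → ℤ} (hf : ∀ i, |f i| ≤ 1) :
    -∑ i, f i ∈ Finset.Icc (-(m : ℤ)) m := by
  have h : |∑ i, f i| ≤ m := by
    simpa using (Finset.abs_sum_le_sum_abs f Finset.univ).trans (Finset.sum_le_sum fun i _ => hf i)
  rw [Finset.mem_Icc]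
  constructor <;> linarith [abs_le.1 h]

lemma eatProb_neg_sum_disp (τ : MovesFirst) {n : ℕ} (S : Strategy n) :
    eatProb τ S (-∑ i, (S.move i).disp.1) (-∑ i, (S.move i).disp.2) = 1 := by
  have hstart : S.final + red n (-∑ i, (S.move i).disp) = S.start := by
    rw [Strategy.final_eq, map_neg, add_neg_cancel_right]
  rw [← Prod.fst_sum, ← Prod.snd_sum, eatProb]
  rw [red_apply, Prod.fst_neg, Prod.snd_neg] at hstart
  rw [hstart, play_self, PMF.pure_apply_self, ENNReal.toReal_one]

lemma one_le_weight (τ : MovesFirst) {n : ℕ} (S : Strategy n) : 1 ≤ weight τ S := by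
  rw [← eatProb_neg_sum_disp τ S, weight, ← Finset.sum_product']
  exact Finset.single_le_sum (f := fun q : ℤ × ℤ => eatProb τ S q.1 q.2)
    (fun _ _ => eatProb_nonneg τ S _ _)
    (Finset.mk_mem_product (neg_sum_mem_Icc fun i => (S.move i).abs_disp_le_one.1)
      (neg_sum_mem_Icc fun i => (S.move i).abs_disp_le_one.2))

lemma one_le_minWeight (τ : MovesFirst) (n : ℕ) : 1 ≤ minWeight τ n :=
  have : Nonempty (Strategy n) := ⟨diagonal n⟩
  le_ciInf fun S => one_le_weight τ S

lemma minWeight_le_weight (τ : MovesFirst) {n : ℕ} (S : Strategy n) :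
    minWeight τ n ≤ weight τ S :=
  ciInf_le ⟨1, Set.forall_mem_range.2 (one_le_weight τ)⟩ S

lemma natCast_pow_three_mul_inv (n : ℕ) :
    (n : ℝ) ^ 3 * ((n : ℝ) ^ (3 / 2 : ℝ))⁻¹ = (n : ℝ) ^ (3 / 2 : ℝ) := by
  rcases n.eq_zero_or_pos with rfl | hn
  · simp
  · have hsq : √(n : ℝ) ^ 2 = n := Real.sq_sqrt n.cast_nonneg
    rw [natCast_rpow_three_halves]
    field_simp
    rw [hsq]

end ZombieTorus

theorem theorem2p3 (τ : ZombieTorus.MovesFirst) :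
    ((fun n : ℕ => ZombieTorus.weight τ (ZombieTorus.diagonal n))
      =O[atTop] fun n : ℕ => (n : ℝ) ^ (3 / 2 : ℝ)) ∧
    ((fun n : ℕ => ZombieTorus.minWeight τ n)
      =O[atTop] fun n : ℕ => (n : ℝ) ^ (3 / 2 : ℝ)) ∧
    (∀ᶠ n : ℕ in atTop, 0 < ZombieTorus.minWeight τ n) ∧
    ((fun n : ℕ => (n : ℝ) ^ (3 / 2 : ℝ))
      =O[atTop] fun n : ℕ => (n : ℝ) ^ 3 / ZombieTorus.minWeight τ n) := by
  have hpos (n : ℕ) : 0 < ZombieTorus.minWeight τ n :=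
    zero_lt_one.trans_le (ZombieTorus.one_le_minWeight τ n)
  have hweight : (fun n : ℕ => ZombieTorus.weight τ (ZombieTorus.diagonal n))
      =O[atTop] fun n : ℕ => (n : ℝ) ^ (3 / 2 : ℝ) := by
    refine .of_bound 22 ?_
    filter_upwards [eventually_ge_atTop 13] with n hn
    rw [Real.norm_of_nonneg (zero_le_one.trans (ZombieTorus.one_le_weight τ _)),
      Real.norm_of_nonneg (by positivity)]
    exact ZombieTorus.weight_diagonal_le τ hn
  have hmin : (fun n : ℕ => ZombieTorus.minWeight τ n)
      =O[atTop] fun n : ℕ => (n : ℝ) ^ (3 / 2 : ℝ) :=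
    (IsBigO.of_norm_le fun n => by
      rw [Real.norm_of_nonneg (hpos n).le]
      exact ZombieTorus.minWeight_le_weight τ _).trans hweight
  refine ⟨hweight, hmin, .of_forall hpos, ?_⟩
  have hinv := hmin.inv_rev (.of_forall fun n h => absurd h (hpos n).ne')
  exact ((isBigO_refl (fun n : ℕ => (n : ℝ) ^ 3) atTop).mul hinv).congr
    ZombieTorus.natCast_pow_three_mul_inv fun _ => (div_eq_mul_inv _ _).symm
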